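/- Let $(M,g)$ be a smooth Riemannian manifold of dimension $n\ge 2$, with scalar product $(\cdot\,|\,\cdot)$, Levi-Civita connection coefficients $\Gamma^k_{ij}$ and curvature $\mathbf R$, where $\mathbf R(X,Y)=[\nabla_X,\nabla_Y]-\nabla_{[X,Y]}$. A Newtonian dynamical system on $M$ is given by a force field $\mathbf F$, a smooth assignment to each point $(p,\mathbf v)$ of $TM$ of a vector $\mathbf F(p,\mathbf v)\in T_pM$. Its trajectories are the smooth curves $p(t)$, $t$ in an open interval $J\subset\mathbb R$, with velocity $\mathbf v=\dot p$, such that $\nabla_t\mathbf v=\mathbf F$. A variation vector on a trajectory is a smooth vector field $\boldsymbol\tau(t)$ along it which satisfies, in every local chart, $$\nabla_{tt}\tau^k=-\sum_{m,i,j}R^k_{mij}\,\tau^i v^j v^m+\sum_m \nabla_t\tau^m\,\tilde\nabla_mF^k+\sum_m\tau^m\,\nabla_mF^k ,$$ $$\tilde\nabla_mF^k=\frac{\partial F^k}{\partial v^m},\qquad \nabla_mF^k=\frac{\partial F^k}{\partial x^m}-\sum_{r,s}\Gamma^r_{ms}v^s\frac{\partial F^k}{\partial v^r}+\sum_s\Gamma^k_{ms}F^s$$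 (equivalently, locally in $t$, $\boldsymbol\tau=\partial x/\partial u|_{u=0}$ for a smooth one-parameter family $x(u,t)$ of trajectories with $x(0,t)=p(t)$). Its function of deviation is $\varphi(t)=(\mathbf v(t)\,|\,\boldsymbol\tau(t))$. The system satisfies the weak normality condition if for each of its trajectories there is an ordinary differential equation $$\ddot\varphi=\mathcal A(t)\,\dot\varphi+\mathcal B(t)\,\varphi ,$$ with smooth coefficients $\mathcal A,\mathcal B$ on $J$ depending only on the trajectory, which is satisfied by the functions of deviation of all variation vectors on this trajectory. Theorem. The geodesic flow on $M$, that is, the Newtonian dynamical system with $\mathbf F\equiv 0$, satisfies the weak normality condition. -/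

import Mathlib

open scoped Manifold ContDiff Bundle

namespace NormalShift

noncomputable section

/-- The model space of coordinates `(x¹, …, xⁿ)`. -/
abbrev Coord (n : ℕ) : Type := EuclideanSpace ℝ (Fin n)

/-- Smooth Riemannian metrics on the smooth manifold `M` of dimension `n`. -/
abbrev Metric (n : ℕ) (M : Type*) [TopologicalSpace M] [ChartedSpace (Coord n) M]
    [IsManifold (𝓡 n) ∞ M] :=
  Bundle.ContMDiffRiemannianMetric (𝓡 n) ∞ (Coord n) (fun p : M => TangentSpace (𝓡 n) p)

/-- The force field `F` of a Newtonian dynamical system on `M`: to each point `(p, v)` of the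
tangent bundle it assigns a vector `F(p, v)` tangent to `M` at `p`, smoothly in `(p, v)`. -/
structure ForceField (n : ℕ) (M : Type*) [TopologicalSpace M] [ChartedSpace (Coord n) M]
    [IsManifold (𝓡 n) ∞ M] where
  force : ∀ p : M, TangentSpace (𝓡 n) p → TangentSpace (𝓡 n) p
  smooth : ContMDiff (𝓡 n).tangent (𝓡 n).tangent ∞
    (fun q : TangentBundle (𝓡 n) M => (⟨q.1, force q.1 q.2⟩ : TangentBundle (𝓡 n) M))

section

variable {n : ℕ} {M : Type*} [TopologicalSpace M] [ChartedSpace (Coord n) M]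

/-! ### Local coordinates -/

/-- Components, in the chart `e`, of the vector `X` tangent to `M` at `p`. -/
def comp (e : OpenPartialHomeomorph M (Coord n)) (p : M) (X : TangentSpace (𝓡 n) p) : Coord n :=
  mfderiv (𝓡 n) (𝓡 n) e p X

/-- The vector tangent to `M` at the point with coordinates `y` in the chart `e`, whose
components in this chart are `w`. -/
def vec (e : OpenPartialHomeomorph M (Coord n)) (y w : Coord n) :
    TangentSpace (𝓡 n) (e.symm y) :=
  mfderiv (𝓡 n) (𝓡 n) e.symm y w

/-- The partial derivative `∂f/∂xⁱ` at `y`. -/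
def pd (i : Fin n) (f : Coord n → ℝ) (y : Coord n) : ℝ :=
  fderiv ℝ f y (EuclideanSpace.single i 1)

/-- The velocity vector of a curve. -/
def velocity (γ : ℝ → M) (t : ℝ) : TangentSpace (𝓡 n) (γ t) :=
  mfderiv 𝓘(ℝ, ℝ) (𝓡 n) γ t (1 : ℝ)

variable [IsManifold (𝓡 n) ∞ M]

/-- The matrix `g_ij` of the metric in the chart `e`, as a function of the coordinates. -/
def gram (g : Metric n M) (e : OpenPartialHomeomorph M (Coord n)) (y : Coord n) :
    Matrix (Fin n) (Fin n) ℝ :=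
  Matrix.of fun i j => g.inner (e.symm y)
    (vec e y (EuclideanSpace.single i 1)) (vec e y (EuclideanSpace.single j 1))

/-- The components `Γ^k_ij` of the metric connection:
`Γ^k_ij = ½ ∑ₛ g^ks (∂g_sj/∂xⁱ + ∂g_is/∂xʲ - ∂g_ij/∂xˢ)`. -/
def christoffel (g : Metric n M) (e : OpenPartialHomeomorph M (Coord n)) (k i j : Fin n)
    (y : Coord n) : ℝ :=
  (1 / 2) * ∑ s, (gram g e y)⁻¹ k s *
    (pd i (fun z => gram g e z s j) y + pd j (fun z => gram g e z i s) y
      - pd s (fun z => gram g e z i j) y)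

/-- The components `R^k_mij` of the curvature tensor, so that
`(R(X, Y) Z)^k = ∑ R^k_mij Xⁱ Yʲ Z^m` where `R(X, Y) = [∇_X, ∇_Y] - ∇_[X, Y]`. -/
def curvature (g : Metric n M) (e : OpenPartialHomeomorph M (Coord n)) (k m i j : Fin n)
    (y : Coord n) : ℝ :=
  pd i (christoffel g e k j m) y - pd j (christoffel g e k i m) y
    + ∑ s, (christoffel g e k i s y * christoffel g e s j m y
      - christoffel g e k j s y * christoffel g e s i m y)

/-- The component `F^k` of the force field in the chart `e`, as a function of the coordinates
`y = (x¹, …, xⁿ)` and of the components `w = (v¹, …, vⁿ)` of the velocity. -/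
def forceComp (F : ForceField n M) (e : OpenPartialHomeomorph M (Coord n)) (k : Fin n)
    (y w : Coord n) : ℝ :=
  comp e (e.symm y) (F.force (e.symm y) (vec e y w)) k

/-- The velocity gradient `∇̃_m F^k = ∂F^k/∂v^m`. -/
def velocityGrad (F : ForceField n M) (e : OpenPartialHomeomorph M (Coord n)) (m k : Fin n)
    (y w : Coord n) : ℝ :=
  pd m (fun u => forceComp F e k y u) w

/-- The spatial gradient of the force field,
`∇_m F^k = ∂F^k/∂x^m - ∑ Γ^r_ms v^s ∂F^k/∂v^r + ∑ Γ^k_ms F^s`. -/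
def spatialGrad (g : Metric n M) (F : ForceField n M) (e : OpenPartialHomeomorph M (Coord n))
    (m k : Fin n) (y w : Coord n) : ℝ :=
  pd m (fun z => forceComp F e k z w) y
    - ∑ r, ∑ s, christoffel g e r m s y * w s * velocityGrad F e r k y w
    + ∑ s, christoffel g e k m s y * forceComp F e s y w

/-- Components in the chart `e` of the covariant derivative, with respect to `t`, of the vector
field along `γ` with components `W`: `∇ₜ W^k = dW^k/dt + ∑ Γ^k_ij vⁱ Wʲ`, `v` the velocity. -/
def covDeriv (g : Metric n M) (e : OpenPartialHomeomorph M (Coord n)) (γ : ℝ → M)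
    (W : ℝ → Fin n → ℝ) (t : ℝ) (k : Fin n) : ℝ :=
  deriv (fun s => W s k) t
    + ∑ i, ∑ j, christoffel g e k i j (e (γ t)) * comp e (γ t) (velocity γ t) i * W t j

/-! ### Trajectories, variation vectors, functions of deviation -/

/-- On the open interval `J`, the curve `γ` is a trajectory of the Newtonian dynamical system with
force field `F`: it is smooth and `∇ₜ v^k = F^k(γ, v)`, `v` its velocity, in all local
coordinates. -/
structure IsTrajectory (g : Metric n M) (F : ForceField n M) (J : Set ℝ) (γ : ℝ → M) : Prop where
  isOpen : IsOpen J
  ordConnected : J.OrdConnected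
  smooth : ContMDiffOn 𝓘(ℝ, ℝ) (𝓡 n) ∞ γ J
  newton : ∀ e ∈ IsManifold.maximalAtlas (𝓡 n) ∞ M, ∀ t ∈ J, γ t ∈ e.source → ∀ k : Fin n,
    covDeriv g e γ (fun s => comp e (γ s) (velocity γ s)) t k
      = forceComp F e k (e (γ t)) (comp e (γ t) (velocity γ t))

/-- The vector field `τ` along `γ` satisfies on `J` the differential equation of variation
`∇ₜₜ τ = C(∇ₜτ ⊗ ∇̃F) + C(τ ⊗ ∇F) - R(τ, v)v`, written out in all local coordinates. -/
def SolvesVariationEq (g : Metric n M) (F : ForceField n M) (J : Set ℝ) (γ : ℝ → M)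
    (τ : ∀ t, TangentSpace (𝓡 n) (γ t)) : Prop :=
  ∀ e ∈ IsManifold.maximalAtlas (𝓡 n) ∞ M, ∀ t ∈ J, γ t ∈ e.source → ∀ k : Fin n,
    let x : Coord n := e (γ t)
    let v : Coord n := comp e (γ t) (velocity γ t)
    let T : ℝ → Fin n → ℝ := fun s => comp e (γ s) (τ s)
    covDeriv g e γ (covDeriv g e γ T) t k
      = - ∑ m, ∑ i, ∑ j, curvature g e k m i j x * T t i * v j * v m
        + ∑ m, covDeriv g e γ T t m * velocityGrad F e m k x v
        + ∑ m, T t m * spatialGrad g F e m k x v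

/-- Near each point of `J`, the vector field `τ` is the derivative `∂x/∂u` at `u = 0` of a smooth
family `x(u, t)` of trajectories with `x(0, t) = γ(t)`. -/
def IsVariationOfFamily (g : Metric n M) (F : ForceField n M) (J : Set ℝ) (γ : ℝ → M)
    (τ : ∀ t, TangentSpace (𝓡 n) (γ t)) : Prop :=
  ∀ t₀ ∈ J, ∃ ε > 0, ∃ x : ℝ → ℝ → M,
    ContMDiffOn 𝓘(ℝ, ℝ × ℝ) (𝓡 n) ∞ (fun q : ℝ × ℝ => x q.1 q.2)
      (Set.Ioo (-ε) ε ×ˢ Set.Ioo (t₀ - ε) (t₀ + ε)) ∧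
    (∀ u ∈ Set.Ioo (-ε) ε, IsTrajectory g F (Set.Ioo (t₀ - ε) (t₀ + ε)) (x u)) ∧
    ∀ t ∈ Set.Ioo (t₀ - ε) (t₀ + ε),
      (⟨γ t, τ t⟩ : TangentBundle (𝓡 n) M)
        = ⟨x 0 t, mfderiv 𝓘(ℝ, ℝ) (𝓡 n) (fun u => x u t) 0 (1 : ℝ)⟩

/-- Variation vectors on a trajectory `γ`: the smooth vector fields along `γ` that come from
families of trajectories, equivalently the solutions of the differential equation of variation.
Both descriptions are admitted, so that nothing hinges on their equivalence. -/
def IsVariationVector (g : Metric n M) (F : ForceField n M) (J : Set ℝ) (γ : ℝ → M)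
    (τ : ∀ t, TangentSpace (𝓡 n) (γ t)) : Prop :=
  ContMDiffOn 𝓘(ℝ, ℝ) (𝓡 n).tangent ∞ (fun t => (⟨γ t, τ t⟩ : TangentBundle (𝓡 n) M)) J ∧
    (SolvesVariationEq g F J γ τ ∨ IsVariationOfFamily g F J γ τ)

/-- The function of deviation `φ(t) = (v(t) | τ(t))`. -/
def deviation (g : Metric n M) (γ : ℝ → M) (τ : ∀ t, TangentSpace (𝓡 n) (γ t)) (t : ℝ) : ℝ :=
  g.inner (γ t) (velocity γ t) (τ t)

/-- `φ` is on `J` a (genuinely twice differentiable) solution of `φ'' = A(t) φ' + B(t) φ`. -/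
def SolvesODE (J : Set ℝ) (A B φ : ℝ → ℝ) : Prop :=
  ∀ t ∈ J, DifferentiableAt ℝ φ t ∧ HasDerivAt (deriv φ) (A t * deriv φ t + B t * φ t) t

/-- The weak normality condition: for each trajectory there is an ordinary differential equation
`φ'' = A(t) φ' + B(t) φ`, with smooth coefficients, which is satisfied by the functions of
deviation of all variation vectors on this trajectory. -/
def WeakNormality (g : Metric n M) (F : ForceField n M) : Prop :=
  ∀ (J : Set ℝ) (γ : ℝ → M), IsTrajectory g F J γ →
    ∃ A B : ℝ → ℝ, ContDiffOn ℝ ∞ A J ∧ ContDiffOn ℝ ∞ B J ∧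
      ∀ τ : ∀ t, TangentSpace (𝓡 n) (γ t), IsVariationVector g F J γ τ →
        SolvesODE J A B (deviation g γ τ)

end

/-- The geodesic flow is the Newtonian dynamical system with identically zero force field. -/
def geodesicFlow (n : ℕ) (M : Type*) [TopologicalSpace M] [ChartedSpace (Coord n) M]
    [IsManifold (𝓡 n) ∞ M] : ForceField n M where
  force _ _ := 0
  smooth := (Bundle.contMDiff_zeroSection ℝ (fun p : M => TangentSpace (𝓡 n) p)).comp
    (Bundle.contMDiff_proj (fun p : M => TangentSpace (𝓡 n) p))

end

end NormalShift

namespace NormalShift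

noncomputable section

open scoped Matrix Topology
open Bundle IsManifold

section

variable {n : ℕ} {M : Type*} [TopologicalSpace M] [ChartedSpace (Coord n) M]

/-! ### The metric in local coordinates -/

/-! For the geodesic flow `φ'' = 0` for every variation vector, so the coefficients `A = B = 0`
serve all trajectories. Since `∇ₜ v = 0` and the connection is metric, `φ' = (v | ∇ₜ τ)`. The two
descriptions of variation vectors are then treated by independent arguments.

If `τ` solves the variation equation, then `φ'' = (v | ∇ₜₜ τ) = -(v | R(τ, v) v)`, which vanishes
because `R(X, Y)` is skew-adjoint (`dotProduct_gram_curvature`). If `τ = ∂x/∂u` for a family of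
geodesics, then `∇ₜ ∂ᵤx = ∇ᵤ ∂ₜx` (`covDeriv_comm`) gives `φ' = ½ ∂ᵤ|∂ₜx|²`, and each geodesic has
constant speed, so `φ'` does not depend on `t`; curvature does not enter.

Both arguments are local and run in one chart, where the metric is the matrix `gram` and the
connection a family of matrices; the product rule `hasDerivAt_gram_covDeriv` drives them. -/

lemma mdifferentiable_of_mem_maximalAtlas {e : OpenPartialHomeomorph M (Coord n)}
    (he : e ∈ maximalAtlas (𝓡 n) ∞ M) : e.MDifferentiable (𝓡 n) (𝓡 n) :=
  ⟨(contMDiffOn_of_mem_maximalAtlas he).mdifferentiableOn (by simp),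
    (contMDiffOn_symm_of_mem_maximalAtlas he).mdifferentiableOn (by simp)⟩

lemma vec_comp {e : OpenPartialHomeomorph M (Coord n)} (he : e ∈ maximalAtlas (𝓡 n) ∞ M)
    {y : Coord n} (hy : y ∈ e.target) (X : TangentSpace (𝓡 n) (e.symm y)) :
    vec e y (comp e (e.symm y) X) = X := by
  have h := (mdifferentiable_of_mem_maximalAtlas he).symm_comp_deriv (e.map_target hy)
  rw [e.right_inv hy] at h
  exact DFunLike.congr_fun h X

lemma comp_vec {e : OpenPartialHomeomorph M (Coord n)} (he : e ∈ maximalAtlas (𝓡 n) ∞ M)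
    {y : Coord n} (hy : y ∈ e.target) (w : Coord n) :
    comp e (e.symm y) (vec e y w) = w :=
  DFunLike.congr_fun ((mdifferentiable_of_mem_maximalAtlas he).comp_symm_deriv hy) w

lemma vec_eq_sum (e : OpenPartialHomeomorph M (Coord n)) (y w : Coord n) :
    vec e y w = ∑ i, w i • vec e y (EuclideanSpace.single i 1) := by
  have hw : w = ∑ i, w i • EuclideanSpace.single i (1 : ℝ) := by
    ext j
    simp [Finset.sum_apply, Pi.single_apply]
  unfold vec
  conv_lhs => rw [hw]
  exact (map_sum (mfderiv (𝓡 n) (𝓡 n) e.symm y) _ _).trans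
    (Finset.sum_congr rfl fun i _ => map_smul (mfderiv (𝓡 n) (𝓡 n) e.symm y) _ _)

lemma contDiffAt_chart_comp {e : OpenPartialHomeomorph M (Coord n)}
    (he : e ∈ maximalAtlas (𝓡 n) ∞ M) {E : Type*} [NormedAddCommGroup E] [NormedSpace ℝ E]
    {f : E → M} {q : E} (hf : ContMDiffAt 𝓘(ℝ, E) (𝓡 n) ∞ f q) (hq : f q ∈ e.source) :
    ContDiffAt ℝ ∞ (fun s => e (f s)) q := by
  rw [← contMDiffAt_iff_contDiffAt]
  exact (contMDiffAt_of_mem_maximalAtlas he hq).comp q hf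

lemma comp_velocity {e : OpenPartialHomeomorph M (Coord n)} (he : e ∈ maximalAtlas (𝓡 n) ∞ M)
    {γ : ℝ → M} {t : ℝ} (hγ : ContMDiffAt 𝓘(ℝ, ℝ) (𝓡 n) ∞ γ t) (ht : γ t ∈ e.source) :
    comp e (γ t) (velocity γ t) = deriv (fun s => e (γ s)) t := by
  have h1 := (mdifferentiable_of_mem_maximalAtlas he).mdifferentiableAt ht
  have h2 := hγ.mdifferentiableAt (by simp)
  have h3 := mfderiv_comp t h1 h2
  rw [mfderiv_eq_fderiv] at h3
  change _ = fderiv ℝ (e ∘ γ) t 1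
  exact (DFunLike.congr_fun h3 (1 : ℝ)).symm

variable [IsManifold (𝓡 n) ∞ M]

lemma inner_vec (g : Metric n M) (e : OpenPartialHomeomorph M (Coord n)) (y v w : Coord n) :
    g.inner (e.symm y) (vec e y v) (vec e y w) = v.ofLp ⬝ᵥ (gram g e y *ᵥ w.ofLp) := by
  rw [vec_eq_sum e y v, vec_eq_sum e y w]
  simp only [map_sum, map_smul, sum_apply, smul_apply,
    smul_eq_mul, dotProduct, Matrix.mulVec, gram, Matrix.of_apply, Finset.mul_sum]
  rw [Finset.sum_comm]
  refine Finset.sum_congr rfl fun i _ => Finset.sum_congr rfl fun j _ => ?_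
  ring

lemma inner_eq_gram (g : Metric n M) {e : OpenPartialHomeomorph M (Coord n)}
    (he : e ∈ maximalAtlas (𝓡 n) ∞ M) {p : M} (hp : p ∈ e.source)
    (X Y : TangentSpace (𝓡 n) p) :
    g.inner p X Y = (comp e p X).ofLp ⬝ᵥ (gram g e (e p) *ᵥ (comp e p Y).ofLp) := by
  obtain ⟨y, hy, rfl⟩ : ∃ y ∈ e.target, e.symm y = p := ⟨e p, e.map_source hp, e.left_inv hp⟩
  rw [e.right_inv hy, ← inner_vec, vec_comp he hy, vec_comp he hy]

lemma gram_transpose (g : Metric n M) (e : OpenPartialHomeomorph M (Coord n)) (y : Coord n) :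
    (gram g e y)ᵀ = gram g e y := by
  ext i j
  exact g.symm _ _ _

/-- Positive definiteness: a nonzero kernel vector of the Gram matrix would be the components of a
nonzero tangent vector of length zero. -/
lemma gram_isUnit_det (g : Metric n M) {e : OpenPartialHomeomorph M (Coord n)}
    (he : e ∈ maximalAtlas (𝓡 n) ∞ M) {y : Coord n} (hy : y ∈ e.target) :
    IsUnit (gram g e y).det := by
  rw [isUnit_iff_ne_zero]
  intro h0
  obtain ⟨w, hw, hgw⟩ := Matrix.exists_mulVec_eq_zero_iff.mpr h0
  have hne : vec e y (WithLp.toLp 2 w) ≠ 0 := by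
    intro h
    apply hw
    have := comp_vec he hy (WithLp.toLp 2 w)
    rw [h] at this
    have h2 : (0 : Coord n) = WithLp.toLp 2 w := by
      rw [← this]; exact (map_zero (mfderiv (𝓡 n) (𝓡 n) e (e.symm y))).symm
    simpa using congrArg WithLp.ofLp h2.symm
  have := g.pos _ _ hne
  rw [inner_vec] at this
  simp [hgw] at this

/-- The coordinate fields are the tangent map of `e.symm` applied to constant fields, hence smooth
along `e.symm`; the entry is the smooth metric evaluated on two of them. -/
lemma contDiffOn_gram (g : Metric n M) {e : OpenPartialHomeomorph M (Coord n)}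
    (he : e ∈ maximalAtlas (𝓡 n) ∞ M) (i j : Fin n) :
    ContDiffOn ℝ ∞ (fun y => gram g e y i j) e.target := by
  rw [← contMDiffOn_iff_contDiffOn]
  have hsymm := contMDiffOn_symm_of_mem_maximalAtlas (I := 𝓡 n) he
  have hvec : ∀ w : Coord n, ContMDiffOn (𝓡 n) (𝓡 n).tangent ∞
      (fun y => TotalSpace.mk' (Coord n) (E := (TangentSpace (𝓡 n) : M → Type _))
        (e.symm y) (vec e y w)) e.target := by
    intro w
    have h1 := hsymm.contMDiffOn_tangentMapWithin (m := ∞) (by simp)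
      e.open_target.uniqueMDiffOn
    have h2 : ContMDiff (𝓡 n) (𝓡 n).tangent ∞
        (fun y : Coord n => (⟨y, w⟩ : TangentBundle (𝓡 n) (Coord n))) := by
      exact contMDiff_vectorSpace_iff_contDiff.mpr contDiff_const
    refine (h1.comp h2.contMDiffOn (fun y hy => hy)).congr fun y hy => ?_
    simp only [Function.comp, tangentMapWithin, vec]
    rw [mfderivWithin_of_isOpen e.open_target hy]
  have hg : ContMDiffOn (𝓡 n) ((𝓡 n).prod 𝓘(ℝ, Coord n →L[ℝ] Coord n →L[ℝ] ℝ)) ∞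
      (fun y => TotalSpace.mk' (Coord n →L[ℝ] Coord n →L[ℝ] ℝ)
        (E := fun p : M => (TangentSpace (𝓡 n) p →L[ℝ] TangentSpace (𝓡 n) p →L[ℝ] ℝ))
        (e.symm y) (g.inner (e.symm y))) e.target :=
    g.contMDiff.comp_contMDiffOn hsymm
  have := ContMDiffOn.clm_bundle_apply₂ (F₁ := Coord n) (F₂ := Coord n) (F₃ := ℝ)
    (E₃ := Bundle.Trivial M ℝ) hg (hvec (EuclideanSpace.single i 1))
    (hvec (EuclideanSpace.single j 1))
  intro y hy
  have h := this y hy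
  rw [Bundle.contMDiffWithinAt_totalSpace] at h
  exact h.2

/-! ### Curves and vector fields in local coordinates -/

lemma contDiffAt_comp_vectorField {e : OpenPartialHomeomorph M (Coord n)}
    (he : e ∈ maximalAtlas (𝓡 n) ∞ M) {γ : ℝ → M} {τ : ∀ t, TangentSpace (𝓡 n) (γ t)} {t : ℝ}
    (hτ : ContMDiffAt 𝓘(ℝ, ℝ) (𝓡 n).tangent ∞
      (fun t => (⟨γ t, τ t⟩ : TangentBundle (𝓡 n) M)) t) (ht : γ t ∈ e.source) :
    ContDiffAt ℝ ∞ (fun s => comp e (γ s) (τ s)) t := by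
  rw [← contMDiffAt_iff_contDiffAt]
  have h1 := (contMDiffOn_of_mem_maximalAtlas (I := 𝓡 n) he).contMDiffOn_tangentMapWithin (m := ∞)
    (by simp) e.open_source.uniqueMDiffOn
  have hopen : IsOpen (TotalSpace.proj (F := Coord n) (E := (TangentSpace (𝓡 n) : M → Type _))
      ⁻¹' e.source) := e.open_source.preimage (FiberBundle.continuous_proj _ _)
  have h2 := h1.contMDiffAt (hopen.mem_nhds (x := ⟨γ t, τ t⟩) ht)
  have h3 := (contMDiff_snd_tangentBundle_modelSpace (Coord n) (𝓡 n) (n := ∞)).contMDiffAt.comp t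
    (h2.comp t hτ)
  refine h3.congr_of_eventuallyEq ?_
  filter_upwards [hτ.continuousAt (hopen.mem_nhds (x := ⟨γ t, τ t⟩) ht)] with s hs
  have hs' : γ s ∈ e.source := hs
  simp only [Function.comp, tangentMapWithin, comp]
  rw [mfderivWithin_of_isOpen e.open_source hs']

end

section

variable {n : ℕ}

/-! ### Partial derivatives of matrix-valued functions -/

lemma contDiffAt_pd {f : Coord n → ℝ} {y : Coord n} (hf : ContDiffAt ℝ ∞ f y) (i : Fin n) :
    ContDiffAt ℝ ∞ (pd i f) y :=
  (hf.fderiv_right (m := ∞) (by simp)).clm_apply contDiffAt_const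

lemma pd_comm {f : Coord n → ℝ} {y : Coord n} (hf : ContDiffAt ℝ ∞ f y) (i j : Fin n) :
    pd i (pd j f) y = pd j (pd i f) y := by
  have hd : DifferentiableAt ℝ (fderiv ℝ f) y :=
    (hf.fderiv_right (m := ∞) (by simp)).differentiableAt (by simp)
  have key : ∀ a b : Fin n, pd a (pd b f) y =
      fderiv ℝ (fderiv ℝ f) y (EuclideanSpace.single a 1) (EuclideanSpace.single b 1) := by
    intro a b
    unfold pd
    rw [fderiv_clm_apply hd (differentiableAt_const _)]
    simp
  rw [key, key]
  exact hf.isSymmSndFDerivAt (by simp; exact WithTop.coe_le_coe.mpr le_top) _ _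

/-- The matrix of the partial derivatives of the entries of `N`. -/
def pdMatrix (i : Fin n) (N : Coord n → Matrix (Fin n) (Fin n) ℝ) (y : Coord n) :
    Matrix (Fin n) (Fin n) ℝ :=
  Matrix.of fun a b => pd i (fun z => N z a b) y

section

variable {N P : Coord n → Matrix (Fin n) (Fin n) ℝ} {y : Coord n} (i : Fin n)

lemma pdMatrix_congr (h : ∀ᶠ z in 𝓝 y, N z = P z) : pdMatrix i N y = pdMatrix i P y := by
  ext a b
  have : (fun z => N z a b) =ᶠ[𝓝 y] fun z => P z a b := h.mono fun z hz => by simp only [hz]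
  simp only [pdMatrix, Matrix.of_apply, pd, this.fderiv_eq]

lemma pdMatrix_transpose : pdMatrix i (fun z => (N z)ᵀ) y = (pdMatrix i N y)ᵀ := rfl

lemma pdMatrix_add (hN : ∀ a b, DifferentiableAt ℝ (fun z => N z a b) y)
    (hP : ∀ a b, DifferentiableAt ℝ (fun z => P z a b) y) :
    pdMatrix i (fun z => N z + P z) y = pdMatrix i N y + pdMatrix i P y := by
  ext a b
  simp only [pdMatrix, Matrix.of_apply, pd, Matrix.add_apply]
  rw [fderiv_fun_add (hN a b) (hP a b)]
  rfl

lemma pdMatrix_mul (hN : ∀ a b, DifferentiableAt ℝ (fun z => N z a b) y)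
    (hP : ∀ a b, DifferentiableAt ℝ (fun z => P z a b) y) :
    pdMatrix i (fun z => N z * P z) y = pdMatrix i N y * P y + N y * pdMatrix i P y := by
  ext a b
  simp only [pdMatrix, Matrix.of_apply, pd, Matrix.add_apply, Matrix.mul_apply]
  rw [fderiv_fun_sum fun s _ => (hN a s).fun_mul (hP s b), sum_apply, ← Finset.sum_add_distrib]
  refine Finset.sum_congr rfl fun s _ => ?_
  rw [fderiv_fun_mul (hN a s) (hP s b)]
  simp
  ring

end

lemma contDiffAt_det {N : Coord n → Matrix (Fin n) (Fin n) ℝ} {y : Coord n}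
    (hN : ∀ a b, ContDiffAt ℝ ∞ (fun z => N z a b) y) :
    ContDiffAt ℝ ∞ (fun z => (N z).det) y := by
  simp only [Matrix.det_apply]
  refine ContDiffAt.sum fun σ _ => ContDiffAt.const_smul _ ?_
  exact contDiffAt_prod fun a _ => hN _ _

lemma contDiffAt_inv_apply {N : Coord n → Matrix (Fin n) (Fin n) ℝ} {y : Coord n}
    (hN : ∀ a b, ContDiffAt ℝ ∞ (fun z => N z a b) y) (hy : IsUnit (N y).det) (a b : Fin n) :
    ContDiffAt ℝ ∞ (fun z => (N z)⁻¹ a b) y := by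
  simp only [Matrix.inv_def, Matrix.smul_apply, Ring.inverse_eq_inv', smul_eq_mul,
    Matrix.adjugate_apply]
  refine ((contDiffAt_det hN).inv hy.ne_zero).mul (contDiffAt_det fun c d => ?_)
  -- The adjugate entry is the determinant of `N z` with row `b` replaced by a constant unit vector.
  by_cases h : c = b
  · subst h
    simpa using contDiffAt_const
  · simpa [Matrix.updateRow_ne h] using hN c d

/-! ### The metric connection and its curvature in local coordinates -/

variable {M : Type*} [TopologicalSpace M] [ChartedSpace (Coord n) M] [IsManifold (𝓡 n) ∞ M]

/-- The connection matrix `(Γ^k_im)` in the direction of the `i`-th coordinate. -/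
def connMatrix (g : Metric n M) (e : OpenPartialHomeomorph M (Coord n)) (i : Fin n)
    (y : Coord n) : Matrix (Fin n) (Fin n) ℝ :=
  Matrix.of fun k m => christoffel g e k i m y

/-- The connection matrix `(∑ Γ^k_im wⁱ)` in the direction of the vector `w`. -/
def conn (g : Metric n M) (e : OpenPartialHomeomorph M (Coord n)) (y : Coord n)
    (w : Fin n → ℝ) : Matrix (Fin n) (Fin n) ℝ :=
  ∑ i, w i • connMatrix g e i y

variable (g : Metric n M) {e : OpenPartialHomeomorph M (Coord n)}

lemma gram_symm (e : OpenPartialHomeomorph M (Coord n)) (y : Coord n) (i j : Fin n) :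
    gram g e y i j = gram g e y j i :=
  g.symm _ _ _

lemma christoffel_symm (e : OpenPartialHomeomorph M (Coord n)) (k i j : Fin n) (y : Coord n) :
    christoffel g e k i j y = christoffel g e k j i y := by
  unfold christoffel
  simp only [gram_symm g e _ _ j, gram_symm g e _ i _]
  congr 1
  refine Finset.sum_congr rfl fun s _ => ?_
  ring

/-- Absence of torsion in matrix form; this is what makes mixed covariant derivatives agree. -/
lemma conn_mulVec_comm (e : OpenPartialHomeomorph M (Coord n)) (y : Coord n) (v w : Fin n → ℝ) :
    conn g e y v *ᵥ w = conn g e y w *ᵥ v := by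
  ext k
  simp only [conn, connMatrix, Matrix.mulVec, dotProduct, Matrix.sum_apply, Matrix.smul_apply,
    Matrix.of_apply, smul_eq_mul, Finset.sum_mul]
  rw [Finset.sum_comm]
  refine Finset.sum_congr rfl fun i _ => Finset.sum_congr rfl fun j _ => ?_
  rw [christoffel_symm]
  ring

variable (he : e ∈ maximalAtlas (𝓡 n) ∞ M) {y : Coord n} (hy : y ∈ e.target)
include he hy

lemma contDiffAt_gram (i j : Fin n) : ContDiffAt ℝ ∞ (fun y => gram g e y i j) y :=
  (contDiffOn_gram g he i j).contDiffAt (e.open_target.mem_nhds hy)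

lemma contDiffAt_christoffel (k i j : Fin n) : ContDiffAt ℝ ∞ (christoffel g e k i j) y := by
  have hG := contDiffAt_gram g he hy
  refine contDiffAt_const.mul (ContDiffAt.sum fun s _ => ?_)
  exact (contDiffAt_inv_apply hG (gram_isUnit_det g he hy) k s).mul
    (((contDiffAt_pd (hG s j) i).add (contDiffAt_pd (hG i s) j)).sub (contDiffAt_pd (hG i j) s))

lemma differentiableAt_gram (i j : Fin n) : DifferentiableAt ℝ (fun y => gram g e y i j) y :=
  (contDiffAt_gram g he hy i j).differentiableAt (by simp)

lemma differentiableAt_connMatrix (i k m : Fin n) :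
    DifferentiableAt ℝ (fun y => connMatrix g e i y k m) y :=
  (contDiffAt_christoffel g he hy k i m).differentiableAt (by simp)

/-- Lowering the upper index cancels the inverse metric and leaves the Christoffel symbols of the
first kind. -/
lemma gram_mul_connMatrix (i : Fin n) :
    gram g e y * connMatrix g e i y = Matrix.of fun l j =>
      (1 / 2) * (pd i (fun z => gram g e z l j) y + pd j (fun z => gram g e z i l) y
        - pd l (fun z => gram g e z i j) y) := by
  have h : connMatrix g e i y = (gram g e y)⁻¹ * Matrix.of fun l j =>
      (1 / 2) * (pd i (fun z => gram g e z l j) y + pd j (fun z => gram g e z i l) y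
        - pd l (fun z => gram g e z i j) y) := by
    ext k j
    simp only [connMatrix, christoffel, Matrix.of_apply, Matrix.mul_apply, Finset.mul_sum]
    refine Finset.sum_congr rfl fun s _ => ?_
    ring
  rw [h, Matrix.mul_nonsing_inv_cancel_left _ _ (gram_isUnit_det g he hy)]

/-- The connection is compatible with the metric. -/
lemma pdMatrix_gram (i : Fin n) :
    pdMatrix i (gram g e) y =
      gram g e y * connMatrix g e i y + (connMatrix g e i y)ᵀ * gram g e y := by
  -- The sum is a matrix plus its transpose: the part of the first-kind symbol antisymmetric in `l,
  -- j` cancels, leaving `∂ᵢ g`.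
  have h : (connMatrix g e i y)ᵀ * gram g e y = (gram g e y * connMatrix g e i y)ᵀ := by
    rw [Matrix.transpose_mul, gram_transpose]
  rw [h, gram_mul_connMatrix g he hy]
  ext a b
  simp only [pdMatrix, Matrix.of_apply, Matrix.add_apply, Matrix.transpose_apply]
  simp only [gram_symm g e _ b a]
  ring

/-- Metric compatibility is differentiated once more and then used again to eliminate `∂ⱼ g`, so
that only `Γ` and `∂Γ` remain beside `g`. -/
lemma pdMatrix_pdMatrix_gram (i j : Fin n) :
    pdMatrix j (pdMatrix i (gram g e)) y =
      (gram g e y * connMatrix g e j y + (connMatrix g e j y)ᵀ * gram g e y) * connMatrix g e i y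
        + gram g e y * pdMatrix j (connMatrix g e i) y
        + ((pdMatrix j (connMatrix g e i) y)ᵀ * gram g e y + (connMatrix g e i y)ᵀ *
          (gram g e y * connMatrix g e j y + (connMatrix g e j y)ᵀ * gram g e y)) := by
  have hev : ∀ᶠ z in 𝓝 y, pdMatrix i (gram g e) z =
      gram g e z * connMatrix g e i z + (connMatrix g e i z)ᵀ * gram g e z := by
    filter_upwards [e.open_target.mem_nhds hy] with z hz using pdMatrix_gram g he hz i
  have hG := differentiableAt_gram g he hy
  have hC := differentiableAt_connMatrix g he hy i
  have hCt : ∀ a b, DifferentiableAt ℝ (fun z => (connMatrix g e i z)ᵀ a b) y := fun a b => hC b a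
  have hmul : ∀ {N P : Coord n → Matrix (Fin n) (Fin n) ℝ},
      (∀ a b, DifferentiableAt ℝ (fun z => N z a b) y) →
      (∀ a b, DifferentiableAt ℝ (fun z => P z a b) y) →
      ∀ a b, DifferentiableAt ℝ (fun z => (N z * P z) a b) y := by
    intro N P hN hP a b
    simp only [Matrix.mul_apply]
    exact DifferentiableAt.fun_sum fun s _ => (hN a s).mul (hP s b)
  rw [pdMatrix_congr j hev, pdMatrix_add j (hmul hG hC) (hmul hCt hG), pdMatrix_mul j hG hC,
    pdMatrix_mul j hCt hG, pdMatrix_transpose, pdMatrix_gram g he hy]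

/-- The curvature operators are skew-adjoint with respect to the metric. -/
lemma gram_mul_curvature_skew (i j : Fin n) :
    gram g e y * (Matrix.of fun k m => curvature g e k m i j y)
      + (Matrix.of fun k m => curvature g e k m i j y)ᵀ * gram g e y = 0 := by
  have hR : (Matrix.of fun k m => curvature g e k m i j y) =
      pdMatrix i (connMatrix g e j) y - pdMatrix j (connMatrix g e i) y
        + (connMatrix g e i y * connMatrix g e j y
          - connMatrix g e j y * connMatrix g e i y) := by
    ext k m
    simp only [curvature, pdMatrix, connMatrix, Matrix.of_apply, Matrix.add_apply,
      Matrix.sub_apply, Matrix.mul_apply, Finset.sum_sub_distrib]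
  have hcomm : pdMatrix i (pdMatrix j (gram g e)) y = pdMatrix j (pdMatrix i (gram g e)) y := by
    ext a b
    exact pd_comm (contDiffAt_gram g he hy a b) i j
  -- In the difference `∂ᵢ∂ⱼ g - ∂ⱼ∂ᵢ g = 0` the cross terms `Γᵀ g Γ` cancel, and what remains is
  -- exactly `g R + Rᵀ g`.
  rw [pdMatrix_pdMatrix_gram g he hy, pdMatrix_pdMatrix_gram g he hy, ← sub_eq_zero] at hcomm
  rw [hR, ← hcomm]
  simp only [Matrix.transpose_add, Matrix.transpose_sub, Matrix.transpose_mul]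
  noncomm_ring

/-- A skew-adjoint operator satisfies `(w | R w) = -(w | R w)`. -/
lemma dotProduct_gram_curvature (i j : Fin n) (w : Fin n → ℝ) :
    w ⬝ᵥ (gram g e y *ᵥ ((Matrix.of fun k m => curvature g e k m i j y) *ᵥ w)) = 0 := by
  set R : Matrix (Fin n) (Fin n) ℝ := Matrix.of fun k m => curvature g e k m i j y
  have h1 : w ⬝ᵥ ((Rᵀ * gram g e y) *ᵥ w) = w ⬝ᵥ ((gram g e y * R) *ᵥ w) := by
    have : Rᵀ * gram g e y = (gram g e y * R)ᵀ := by
      rw [Matrix.transpose_mul, gram_transpose]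
    rw [this, Matrix.mulVec_transpose, dotProduct_comm, Matrix.dotProduct_mulVec]
  have h2 := congrArg (fun N => w ⬝ᵥ (N *ᵥ w)) (gram_mul_curvature_skew g he hy i j)
  simp only [Matrix.add_mulVec, dotProduct_add, Matrix.zero_mulVec, dotProduct_zero] at h2
  rw [h1] at h2
  rw [Matrix.mulVec_mulVec]
  linarith

/-! ### Covariant differentiation along curves in local coordinates -/

/-- The product rule `d/dt (V | W) = (∇V | W) + (V | ∇W)` along a curve. -/
lemma hasDerivAt_dotProduct_gram {x : ℝ → Coord n} {x' : Coord n} {V W : ℝ → Fin n → ℝ}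
    {V' W' : Fin n → ℝ} {t : ℝ} (hx : HasDerivAt x x' t) (hxt : x t = y)
    (hV : HasDerivAt V V' t) (hW : HasDerivAt W W' t) :
    HasDerivAt (fun s => V s ⬝ᵥ (gram g e (x s) *ᵥ W s))
      ((V' + conn g e y x' *ᵥ V t) ⬝ᵥ (gram g e y *ᵥ W t)
        + V t ⬝ᵥ (gram g e y *ᵥ (W' + conn g e y x' *ᵥ W t))) t := by
  set G' : Matrix (Fin n) (Fin n) ℝ := ∑ i, x' i • pdMatrix i (gram g e) y with hG'
  have hG : ∀ a b, HasDerivAt (fun s => gram g e (x s) a b) (G' a b) t := by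
    intro a b
    subst hxt
    have h := (differentiableAt_gram g he hy a b).hasFDerivAt.comp_hasDerivAt t hx
    refine h.congr_deriv ?_
    have hw : x' = ∑ i, x' i • EuclideanSpace.single i (1 : ℝ) := by
      ext j
      simp [Finset.sum_apply, Pi.single_apply]
    conv_lhs => rw [hw]
    simp [hG', Matrix.sum_apply, pdMatrix, pd]
  -- Compatibility in the direction `x'` splits the derivative of the metric into the connection
  -- terms of `∇W` and of `∇V`.
  have hG'' : G' = gram g e y * conn g e y x' + (conn g e y x')ᵀ * gram g e y := by
    simp only [hG', pdMatrix_gram g he hy, conn, Matrix.mul_sum, Matrix.transpose_sum,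
      Matrix.sum_mul, ← Finset.sum_add_distrib, Matrix.transpose_smul, Matrix.smul_mul,
      Matrix.mul_smul, smul_add]
  have hmain : HasDerivAt (fun s => V s ⬝ᵥ (gram g e (x s) *ᵥ W s))
      (V' ⬝ᵥ (gram g e (x t) *ᵥ W t) + V t ⬝ᵥ (G' *ᵥ W t)
        + V t ⬝ᵥ (gram g e (x t) *ᵥ W')) t := by
    rw [hasDerivAt_pi] at hV hW
    simp only [dotProduct, Matrix.mulVec]
    have h := HasDerivAt.fun_sum (u := Finset.univ) fun a _ => (hV a).fun_mul
      (HasDerivAt.fun_sum (u := Finset.univ) fun b _ => (hG a b).fun_mul (hW b))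
    refine h.congr_deriv ?_
    rw [← Finset.sum_add_distrib, ← Finset.sum_add_distrib]
    refine Finset.sum_congr rfl fun a _ => ?_
    rw [Finset.sum_add_distrib]
    ring
  refine hmain.congr_deriv ?_
  rw [hxt, hG'']
  simp only [Matrix.add_mulVec, Matrix.mulVec_add, dotProduct_add, add_dotProduct,
    Matrix.mulVec_mulVec]
  have : (conn g e y x' *ᵥ V t) ⬝ᵥ (gram g e y *ᵥ W t)
      = V t ⬝ᵥ (((conn g e y x')ᵀ * gram g e y) *ᵥ W t) := by
    rw [← Matrix.mulVec_mulVec, Matrix.mulVec_transpose, dotProduct_comm (V t),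
      ← Matrix.dotProduct_mulVec, dotProduct_comm]
  rw [this]
  ring

end

section

variable {n : ℕ}

lemma hasDerivAt_ofLp {f : ℝ → Coord n} {f' : Coord n} {t : ℝ} (h : HasDerivAt f f' t) :
    HasDerivAt (fun s => (f s).ofLp) f'.ofLp t :=
  (PiLp.continuousLinearEquiv 2 ℝ
    (fun _ : Fin n => ℝ)).toContinuousLinearMap.hasFDerivAt.comp_hasDerivAt t h

/-! ### Mixed second derivatives of maps of two real variables. -/

section

variable {E : Type*} [NormedAddCommGroup E] [NormedSpace ℝ E] {F : ℝ × ℝ → E} {u t : ℝ}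

/-- The value is written as the same expression as in `hasDerivAt_deriv_fst`, so that the two mixed
derivatives match literally in `covDeriv_comm`. -/
lemma hasDerivAt_deriv_snd (hF : ContDiffAt ℝ ∞ F (u, t)) :
    HasDerivAt (fun r => deriv (fun s => F (r, s)) t)
      (fderiv ℝ (fderiv ℝ F) (u, t) (1, 0) (0, 1)) u := by
  have hline : HasDerivAt (fun r : ℝ => (r, t)) ((1 : ℝ), (0 : ℝ)) u :=
    (hasDerivAt_id u).prodMk (hasDerivAt_const u t)
  have h2 : HasFDerivAt (fderiv ℝ F) (fderiv ℝ (fderiv ℝ F) (u, t)) (u, t) :=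
    ((hF.fderiv_right (m := ∞) (by simp)).differentiableAt (by simp)).hasFDerivAt
  have hcomp : HasDerivAt (fun r => fderiv ℝ F (r, t)) (fderiv ℝ (fderiv ℝ F) (u, t) (1, 0)) u :=
    h2.comp_hasDerivAt (f := fun r => (r, t)) u hline
  have h3 := hcomp.clm_apply (hasDerivAt_const u ((0 : ℝ), (1 : ℝ)))
  simp only [map_zero, add_zero] at h3
  refine h3.congr_of_eventuallyEq ?_
  -- Smoothness of a fixed finite order at a point spreads to a neighbourhood; order one is enough
  -- here.
  have hev : ∀ᶠ q in 𝓝 (u, t), ContDiffAt ℝ 1 F q :=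
    (hF.of_le (by exact_mod_cast le_top)).eventually (by simp)
  filter_upwards [hline.continuousAt.eventually hev] with r hr
  have hd : HasFDerivAt F (fderiv ℝ F (r, t)) (r, t) :=
    (hr.differentiableAt (by simp)).hasFDerivAt
  have hline' : HasDerivAt (fun s : ℝ => (r, s)) ((0 : ℝ), (1 : ℝ)) t :=
    (hasDerivAt_const t r).prodMk (hasDerivAt_id t)
  exact (hd.comp_hasDerivAt t hline').deriv

lemma hasDerivAt_deriv_fst (hF : ContDiffAt ℝ ∞ F (u, t)) :
    HasDerivAt (fun s => deriv (fun r => F (r, s)) u)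
      (fderiv ℝ (fderiv ℝ F) (u, t) (1, 0) (0, 1)) t := by
  have hline : HasDerivAt (fun s : ℝ => (u, s)) ((0 : ℝ), (1 : ℝ)) t :=
    (hasDerivAt_const t u).prodMk (hasDerivAt_id t)
  have h2 : HasFDerivAt (fderiv ℝ F) (fderiv ℝ (fderiv ℝ F) (u, t)) (u, t) :=
    ((hF.fderiv_right (m := ∞) (by simp)).differentiableAt (by simp)).hasFDerivAt
  have hcomp : HasDerivAt (fun s => fderiv ℝ F (u, s)) (fderiv ℝ (fderiv ℝ F) (u, t) (0, 1)) t :=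
    h2.comp_hasDerivAt (f := fun s => (u, s)) t hline
  have h3 := hcomp.clm_apply (hasDerivAt_const t ((1 : ℝ), (0 : ℝ)))
  simp only [map_zero, add_zero] at h3
  rw [hF.isSymmSndFDerivAt (by simp; exact WithTop.coe_le_coe.mpr le_top)] at h3
  refine h3.congr_of_eventuallyEq ?_
  have hev : ∀ᶠ q in 𝓝 (u, t), ContDiffAt ℝ 1 F q :=
    (hF.of_le (by exact_mod_cast le_top)).eventually (by simp)
  filter_upwards [hline.continuousAt.eventually hev] with s hs
  have hd : HasFDerivAt F (fderiv ℝ F (u, s)) (u, s) :=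
    (hs.differentiableAt (by simp)).hasFDerivAt
  have hline' : HasDerivAt (fun r : ℝ => (r, s)) ((1 : ℝ), (0 : ℝ)) u :=
    (hasDerivAt_id u).prodMk (hasDerivAt_const u s)
  exact (hd.comp_hasDerivAt u hline').deriv

end

variable {M : Type*} [TopologicalSpace M] [ChartedSpace (Coord n) M] [IsManifold (𝓡 n) ∞ M]
  (g : Metric n M) {e : OpenPartialHomeomorph M (Coord n)}

/-! ### Covariant differentiation along curves -/

lemma covDeriv_eq_add_conn (e : OpenPartialHomeomorph M (Coord n)) (γ : ℝ → M)
    {W : ℝ → Fin n → ℝ} {W' : Fin n → ℝ} {t : ℝ} (hW : HasDerivAt W W' t) :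
    covDeriv g e γ W t
      = W' + conn g e (e (γ t)) (comp e (γ t) (velocity γ t)).ofLp *ᵥ W t := by
  ext k
  rw [hasDerivAt_pi] at hW
  simp only [covDeriv, (hW k).deriv, Pi.add_apply, conn, connMatrix, Matrix.mulVec, dotProduct,
    Matrix.sum_apply, Matrix.smul_apply, Matrix.of_apply, smul_eq_mul, Finset.sum_mul]
  rw [Finset.sum_comm]
  congr 1
  refine Finset.sum_congr rfl fun j _ => Finset.sum_congr rfl fun i _ => ?_
  ring

lemma forceComp_geodesicFlow (e : OpenPartialHomeomorph M (Coord n)) (k : Fin n)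
    (y w : Coord n) : forceComp (geodesicFlow n M) e k y w = 0 := by
  have h : comp e (e.symm y) 0 = 0 := map_zero (mfderiv (𝓡 n) (𝓡 n) e (e.symm y))
  simp [forceComp, geodesicFlow, h]

lemma velocityGrad_geodesicFlow (e : OpenPartialHomeomorph M (Coord n)) (m k : Fin n)
    (y w : Coord n) : velocityGrad (geodesicFlow n M) e m k y w = 0 := by
  simp [velocityGrad, forceComp_geodesicFlow, pd]

lemma spatialGrad_geodesicFlow (e : OpenPartialHomeomorph M (Coord n)) (m k : Fin n)
    (y w : Coord n) : spatialGrad g (geodesicFlow n M) e m k y w = 0 := by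
  simp [spatialGrad, velocityGrad_geodesicFlow, forceComp_geodesicFlow, pd]

variable (he : e ∈ maximalAtlas (𝓡 n) ∞ M)
include he

lemma hasDerivAt_gram_covDeriv {γ : ℝ → M} {t : ℝ} (hγ : ContMDiffAt 𝓘(ℝ, ℝ) (𝓡 n) ∞ γ t)
    (ht : γ t ∈ e.source) {V W : ℝ → Fin n → ℝ} (hV : DifferentiableAt ℝ V t)
    (hW : DifferentiableAt ℝ W t) :
    HasDerivAt (fun s => V s ⬝ᵥ (gram g e (e (γ s)) *ᵥ W s))
      (covDeriv g e γ V t ⬝ᵥ (gram g e (e (γ t)) *ᵥ W t)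
        + V t ⬝ᵥ (gram g e (e (γ t)) *ᵥ covDeriv g e γ W t)) t := by
  rw [covDeriv_eq_add_conn g e γ hV.hasDerivAt, covDeriv_eq_add_conn g e γ hW.hasDerivAt,
    comp_velocity he hγ ht]
  have hx := ((contDiffAt_chart_comp he hγ ht).differentiableAt (by simp)).hasDerivAt
  exact hasDerivAt_dotProduct_gram g he (e.map_source ht) hx rfl hV.hasDerivAt hW.hasDerivAt

omit [IsManifold (𝓡 n) ∞ M] he in
lemma eventually_contMDiffAt_mem_source {E : Type*} [NormedAddCommGroup E] [NormedSpace ℝ E]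
    {f : E → M} {s : Set E} (hs : IsOpen s) (hf : ContMDiffOn 𝓘(ℝ, E) (𝓡 n) ∞ f s) {q : E}
    (hq : q ∈ s) (hqe : f q ∈ e.source) :
    ∀ᶠ r in 𝓝 q, r ∈ s ∧ ContMDiffAt 𝓘(ℝ, E) (𝓡 n) ∞ f r ∧ f r ∈ e.source := by
  have hc : ContinuousAt f q := (hf.contMDiffAt (hs.mem_nhds hq)).continuousAt
  filter_upwards [hs.mem_nhds hq, hc (e.open_source.mem_nhds hqe)] with r hr hre
  exact ⟨hr, hf.contMDiffAt (hs.mem_nhds hr), hre⟩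

omit [IsManifold (𝓡 n) ∞ M] in
lemma contDiffAt_comp_velocity {γ : ℝ → M} {s : Set ℝ} (hs : IsOpen s)
    (hγ : ContMDiffOn 𝓘(ℝ, ℝ) (𝓡 n) ∞ γ s) {t : ℝ} (ht : t ∈ s) (hte : γ t ∈ e.source) :
    ContDiffAt ℝ ∞ (fun s => comp e (γ s) (velocity γ s)) t := by
  have h : ContDiffAt ℝ ∞ (deriv fun s => e (γ s)) t :=
    ((contDiffAt_chart_comp he (hγ.contMDiffAt (hs.mem_nhds ht)) hte).fderiv_right
      (m := ∞) (by simp)).clm_apply contDiffAt_const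
  refine h.congr_of_eventuallyEq ?_
  filter_upwards [eventually_contMDiffAt_mem_source hs hγ ht hte] with r hr
  exact comp_velocity he hr.2.1 hr.2.2

lemma differentiableAt_covDeriv {γ : ℝ → M} {s : Set ℝ} (hs : IsOpen s)
    (hγ : ContMDiffOn 𝓘(ℝ, ℝ) (𝓡 n) ∞ γ s) {t : ℝ} (ht : t ∈ s) (hte : γ t ∈ e.source)
    {W : ℝ → Coord n} (hW : ContDiffAt ℝ ∞ W t) :
    DifferentiableAt ℝ (covDeriv g e γ fun s => (W s).ofLp) t := by
  have hx := contDiffAt_chart_comp he (hγ.contMDiffAt (hs.mem_nhds ht)) hte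
  have hv := contDiffAt_comp_velocity he hs hγ ht hte
  rw [contDiffAt_euclidean] at hv hW
  rw [differentiableAt_pi]
  intro k
  refine ContDiffAt.differentiableAt (n := ∞) ?_ (by simp)
  refine ContDiffAt.add (((hW k).fderiv_right (m := ∞) (by simp)).clm_apply contDiffAt_const)
    (ContDiffAt.sum fun i _ => ContDiffAt.sum fun j _ => ?_)
  exact (((contDiffAt_christoffel g he (e.map_source hte) k i j).comp t hx).mul (hv i)).mul (hW j)

omit he in
lemma covDeriv_velocity_eq_zero {J : Set ℝ} {γ : ℝ → M}
    (hγ : IsTrajectory g (geodesicFlow n M) J γ) (he : e ∈ maximalAtlas (𝓡 n) ∞ M) {t : ℝ}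
    (ht : t ∈ J) (hte : γ t ∈ e.source) :
    covDeriv g e γ (fun s => (comp e (γ s) (velocity γ s)).ofLp) t = 0 := by
  ext k
  rw [hγ.newton e he t ht hte k, forceComp_geodesicFlow]
  rfl

/-- The mixed covariant derivatives of a two-parameter family of points agree. -/
lemma covDeriv_comm {x : ℝ → ℝ → M} {u t : ℝ}
    (hx : ∀ᶠ q in 𝓝 (u, t), ContMDiffAt 𝓘(ℝ, ℝ × ℝ) (𝓡 n) ∞ (fun q : ℝ × ℝ => x q.1 q.2) q ∧
      x q.1 q.2 ∈ e.source) :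
    ∃ a b : Fin n → ℝ,
      HasDerivAt (fun s => (comp e (x u s) (velocity (fun r => x r s) u)).ofLp) a t ∧
      HasDerivAt (fun r => (comp e (x r t) (velocity (fun s => x r s) t)).ofLp) b u ∧
      covDeriv g e (fun s => x u s)
          (fun s => (comp e (x u s) (velocity (fun r => x r s) u)).ofLp) t
        = covDeriv g e (fun r => x r t)
          (fun r => (comp e (x r t) (velocity (fun s => x r s) t)).ofLp) u := by
  have hline1 : ∀ r s : ℝ, ContMDiffAt 𝓘(ℝ, ℝ × ℝ) (𝓡 n) ∞ (fun q : ℝ × ℝ => x q.1 q.2) (r, s) →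
      ContMDiffAt 𝓘(ℝ, ℝ) (𝓡 n) ∞ (fun r => x r s) r := fun r s h =>
    h.comp r (f := fun r => (r, s)) (contDiffAt_id.prodMk contDiffAt_const).contMDiffAt
  have hline2 : ∀ r s : ℝ, ContMDiffAt 𝓘(ℝ, ℝ × ℝ) (𝓡 n) ∞ (fun q : ℝ × ℝ => x q.1 q.2) (r, s) →
      ContMDiffAt 𝓘(ℝ, ℝ) (𝓡 n) ∞ (fun s => x r s) s := fun r s h =>
    h.comp s (f := fun s => (r, s)) (contDiffAt_const.prodMk contDiffAt_id).contMDiffAt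
  obtain ⟨hxm, hxe⟩ := hx.self_of_nhds
  have hF : ContDiffAt ℝ ∞ (fun q : ℝ × ℝ => e (x q.1 q.2)) (u, t) :=
    contDiffAt_chart_comp he hxm hxe
  have h1 : HasDerivAt (fun s => comp e (x u s) (velocity (fun r => x r s) u)) _ t :=
    (hasDerivAt_deriv_fst hF).congr_of_eventuallyEq (by
      have hc : ContinuousAt (fun s : ℝ => (u, s)) t := by fun_prop
      filter_upwards [hc.eventually hx] with s hs
      exact comp_velocity he (hline1 u s hs.1) hs.2)
  have h2 : HasDerivAt (fun r => comp e (x r t) (velocity (fun s => x r s) t)) _ u :=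
    (hasDerivAt_deriv_snd hF).congr_of_eventuallyEq (by
      have hc : ContinuousAt (fun r : ℝ => (r, t)) u := by fun_prop
      filter_upwards [hc.eventually hx] with r hr
      exact comp_velocity he (hline2 r t hr.1) hr.2)
  refine ⟨_, _, hasDerivAt_ofLp h1, hasDerivAt_ofLp h2, ?_⟩
  -- The second partial derivatives already coincide; only the connection terms have to be
  -- exchanged, by symmetry of `Γ`.
  rw [covDeriv_eq_add_conn g e _ (hasDerivAt_ofLp h1),
    covDeriv_eq_add_conn g e _ (hasDerivAt_ofLp h2), conn_mulVec_comm]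

omit he

/-! ### Functions of deviation of the geodesic flow -/

/-- The conclusion is the local form of `φ'' = 0`: `ψ` is `φ'` near `t₀`, expressed as `(v | ∇ₜ τ)`
in a chart around `γ t₀`. -/
lemma hasDerivAt_deviation_of_solvesVariationEq {J : Set ℝ} {γ : ℝ → M}
    (hγ : IsTrajectory g (geodesicFlow n M) J γ) {τ : ∀ t, TangentSpace (𝓡 n) (γ t)}
    (hτ : ContMDiffOn 𝓘(ℝ, ℝ) (𝓡 n).tangent ∞
      (fun t => (⟨γ t, τ t⟩ : TangentBundle (𝓡 n) M)) J)
    (hvar : SolvesVariationEq g (geodesicFlow n M) J γ τ) {t₀ : ℝ} (ht₀ : t₀ ∈ J) :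
    ∃ ψ : ℝ → ℝ, (∀ᶠ t in 𝓝 t₀, HasDerivAt (deviation g γ τ) (ψ t) t) ∧ HasDerivAt ψ 0 t₀ := by
  set e := chartAt (Coord n) (γ t₀)
  have he : e ∈ maximalAtlas (𝓡 n) ∞ M := chart_mem_maximalAtlas _
  have hte : γ t₀ ∈ e.source := mem_chart_source _ _
  have hJ := hγ.isOpen
  have hnear := eventually_contMDiffAt_mem_source hJ hγ.smooth ht₀ hte
  set v : ℝ → Fin n → ℝ := fun s => (comp e (γ s) (velocity γ s)).ofLp with hv
  set T : ℝ → Fin n → ℝ := fun s => (comp e (γ s) (τ s)).ofLp with hT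
  have hvd : ∀ t ∈ J, γ t ∈ e.source → DifferentiableAt ℝ v t := fun t ht hte =>
    (hasDerivAt_ofLp ((contDiffAt_comp_velocity he hJ hγ.smooth ht hte).differentiableAt
      (by simp)).hasDerivAt).differentiableAt
  have hTc : ∀ t ∈ J, γ t ∈ e.source → ContDiffAt ℝ ∞ (fun s => comp e (γ s) (τ s)) t :=
    fun t ht hte => contDiffAt_comp_vectorField he (hτ.contMDiffAt (hJ.mem_nhds ht)) hte
  refine ⟨fun t => v t ⬝ᵥ (gram g e (e (γ t)) *ᵥ covDeriv g e γ T t), ?_, ?_⟩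
  · filter_upwards [hnear.eventually_nhds] with t ht
    obtain ⟨htJ, htm, hte⟩ := ht.self_of_nhds
    have hTd : DifferentiableAt ℝ T t :=
      (hasDerivAt_ofLp ((hTc t htJ hte).differentiableAt (by simp)).hasDerivAt).differentiableAt
    have h := hasDerivAt_gram_covDeriv g he htm hte (hvd t htJ hte) hTd
    rw [hv, covDeriv_velocity_eq_zero g hγ he htJ hte, zero_dotProduct, zero_add] at h
    refine h.congr_of_eventuallyEq ?_
    filter_upwards [ht] with s hs
    exact inner_eq_gram g he hs.2.2 _ _
  · have h := hasDerivAt_gram_covDeriv g he (hγ.smooth.contMDiffAt (hJ.mem_nhds ht₀)) hte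
      (hvd t₀ ht₀ hte) (differentiableAt_covDeriv g he hJ hγ.smooth ht₀ hte (hTc t₀ ht₀ hte))
    refine h.congr_deriv ?_
    rw [hv, covDeriv_velocity_eq_zero g hγ he ht₀ hte, zero_dotProduct, zero_add]
    -- Grouping by `i, j` exhibits operators `R(∂ᵢ, ∂ⱼ)` applied to `v`, each of which is orthogonal
    -- to `v`.
    have hR : covDeriv g e γ (covDeriv g e γ T) t₀ = - ∑ i, ∑ j, (T t₀ i * v t₀ j) •
        ((Matrix.of fun k m => curvature g e k m i j (e (γ t₀))) *ᵥ v t₀) := by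
      ext k
      rw [hvar e he t₀ ht₀ hte k]
      simp only [velocityGrad_geodesicFlow, spatialGrad_geodesicFlow, mul_zero,
        Finset.sum_const_zero, add_zero, Pi.neg_apply, Finset.sum_apply, Pi.smul_apply,
        Matrix.mulVec, dotProduct, Matrix.of_apply, smul_eq_mul, Finset.mul_sum]
      rw [Finset.sum_comm]
      congr 1
      refine Finset.sum_congr rfl fun i _ => ?_
      rw [Finset.sum_comm]
      refine Finset.sum_congr rfl fun j _ => Finset.sum_congr rfl fun m _ => ?_
      simp only [hT, hv]
      ring
    rw [hR]
    simp only [Matrix.mulVec_neg, Matrix.mulVec_sum, Matrix.mulVec_smul, dotProduct_neg,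
      dotProduct_sum, dotProduct_smul]
    rw [neg_eq_zero]
    refine Finset.sum_eq_zero fun i _ => Finset.sum_eq_zero fun j _ => ?_
    rw [dotProduct_gram_curvature g he (e.map_source hte), smul_zero]

/-- Here `φ' = (v | ∇ₜ τ) = (v | ∇ᵤ v) = ½ ∂ᵤ(v | v)` at `u = 0`, and conservation of `(v | v)`
along each member of the family makes it constant in `t`. -/
lemma hasDerivAt_deviation_of_isVariationOfFamily {J : Set ℝ} {γ : ℝ → M}
    {τ : ∀ t, TangentSpace (𝓡 n) (γ t)}
    (hvar : IsVariationOfFamily g (geodesicFlow n M) J γ τ) {t₀ : ℝ} (ht₀ : t₀ ∈ J) :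
    ∃ ψ : ℝ → ℝ, (∀ᶠ t in 𝓝 t₀, HasDerivAt (deviation g γ τ) (ψ t) t) ∧ HasDerivAt ψ 0 t₀ := by
  obtain ⟨ε, hε, x, hx, htraj, hγx⟩ := hvar t₀ ht₀
  set I : Set ℝ := Set.Ioo (t₀ - ε) (t₀ + ε)
  have ht₀I : t₀ ∈ I := ⟨by linarith, by linarith⟩
  set e := chartAt (Coord n) (x 0 t₀)
  have he : e ∈ maximalAtlas (𝓡 n) ∞ M := chart_mem_maximalAtlas _
  have hnear := eventually_contMDiffAt_mem_source (isOpen_Ioo.prod isOpen_Ioo) hx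
    (q := (0, t₀)) ⟨⟨by simpa using hε, hε⟩, ht₀I⟩ (mem_chart_source _ _)
  -- A ball in the product is a product of balls, so a whole square around `(0, t₀)` is mapped into
  -- the one chart.
  obtain ⟨δ, hδ, hball⟩ := Metric.eventually_nhds_iff_ball.mp hnear.eventually_nhds
  have hbox : ∀ u ∈ Metric.ball (0 : ℝ) δ, ∀ t ∈ Metric.ball t₀ δ, ∀ᶠ q : ℝ × ℝ in 𝓝 (u, t),
      q ∈ Set.Ioo (-ε) ε ×ˢ I ∧
      ContMDiffAt 𝓘(ℝ, ℝ × ℝ) (𝓡 n) ∞ (fun q : ℝ × ℝ => x q.1 q.2) q ∧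
      x q.1 q.2 ∈ e.source := fun u hu t ht =>
    hball (u, t) (by rw [← ball_prod_same]; exact ⟨hu, ht⟩)
  have hsmooth : ∀ t ∈ Metric.ball t₀ δ, ContMDiffAt 𝓘(ℝ, ℝ) (𝓡 n) ∞ (fun u => x u t) 0 :=
    fun t ht => (hbox 0 (Metric.mem_ball_self hδ) t ht).self_of_nhds.2.1.comp (0 : ℝ)
      (f := fun u => (u, t)) (contDiffAt_id.prodMk contDiffAt_const).contMDiffAt
  set V : ℝ → ℝ → Fin n → ℝ := fun u t => (comp e (x u t) (velocity (fun s => x u s) t)).ofLp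
    with hV
  set energy : ℝ → ℝ → ℝ := fun u t => V u t ⬝ᵥ (gram g e (e (x u t)) *ᵥ V u t) with henergy
  -- the speed of each trajectory is constant
  have hconst : ∀ u ∈ Metric.ball (0 : ℝ) δ, ∀ t ∈ Metric.ball t₀ δ,
      energy u t = energy u t₀ := by
    intro u hu t ht
    have hd : ∀ s ∈ Metric.ball t₀ δ, HasDerivAt (energy u) 0 s := by
      intro s hs
      obtain ⟨⟨huε, hsI⟩, -, hse⟩ := (hbox u hu s hs).self_of_nhds
      have htr := htraj u huε
      have hVd : DifferentiableAt ℝ (V u) s :=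
        (hasDerivAt_ofLp ((contDiffAt_comp_velocity he isOpen_Ioo htr.smooth hsI hse
          ).differentiableAt (by simp)).hasDerivAt).differentiableAt
      have h := hasDerivAt_gram_covDeriv g he
        (htr.smooth.contMDiffAt (isOpen_Ioo.mem_nhds hsI)) hse hVd hVd
      refine h.congr_deriv ?_
      have h0 : covDeriv g e (x u) (V u) s = 0 := covDeriv_velocity_eq_zero g htr he hsI hse
      simp [h0]
    exact Metric.isOpen_ball.is_const_of_deriv_eq_zero (convex_ball t₀ δ).isPreconnected
      (fun s hs => (hd s hs).differentiableAt.differentiableWithinAt)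
      (fun s hs => (hd s hs).deriv) ht (Metric.mem_ball_self hδ)
  -- With the energy frozen at time `t₀` the candidate for `φ'` is literally constant, so its
  -- derivative is zero at once.
  refine ⟨fun _ => (1 / 2) * deriv (fun u => energy u t₀) 0, ?_, hasDerivAt_const _ _⟩
  filter_upwards [(Metric.isOpen_ball (x := t₀) (ε := δ)).mem_nhds (Metric.mem_ball_self hδ)]
    with t ht
  have h0δ := Metric.mem_ball_self hδ (x := (0 : ℝ))
  obtain ⟨⟨h0ε, htI⟩, -, hte⟩ := (hbox 0 h0δ t ht).self_of_nhds
  have htr := htraj 0 h0ε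
  obtain ⟨a, b, ha, hb, hab⟩ := covDeriv_comm g he ((hbox 0 h0δ t ht).mono fun q hq => hq.2)
  have hVd : DifferentiableAt ℝ (V 0) t :=
    (hasDerivAt_ofLp ((contDiffAt_comp_velocity he isOpen_Ioo htr.smooth htI hte
      ).differentiableAt (by simp)).hasDerivAt).differentiableAt
  have hφ := hasDerivAt_gram_covDeriv g he
    (htr.smooth.contMDiffAt (isOpen_Ioo.mem_nhds htI)) hte hVd ha.differentiableAt
  have hE := hasDerivAt_gram_covDeriv g he (hsmooth t ht) hte
    hb.differentiableAt hb.differentiableAt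
  have hzero : covDeriv g e (x 0) (V 0) t = 0 := covDeriv_velocity_eq_zero g htr he htI hte
  -- Conservation is needed for all `u` near `0`, not only for `u = 0`, since the energy is
  -- differentiated in `u`.
  have hEconst : deriv (fun u => energy u t₀) 0 = deriv (fun u => energy u t) 0 := by
    refine Filter.EventuallyEq.deriv_eq ?_
    filter_upwards [Metric.isOpen_ball.mem_nhds h0δ] with u hu
    exact (hconst u hu t ht).symm
  have hsymm : ∀ v w : Fin n → ℝ, v ⬝ᵥ (gram g e (e (x 0 t)) *ᵥ w)
      = w ⬝ᵥ (gram g e (e (x 0 t)) *ᵥ v) := by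
    intro v w
    rw [Matrix.dotProduct_mulVec, ← Matrix.mulVec_transpose, gram_transpose, dotProduct_comm]
  refine (hφ.congr_deriv ?_).congr_of_eventuallyEq ?_
  · rw [hzero, hEconst, hE.deriv, hab, zero_dotProduct, zero_add,
      hsymm (covDeriv g e (fun r => x r t) _ 0)]
    ring
  -- The vectors `τ s` and `∂x/∂u` lie in fibres that are not definitionally equal, so they are
  -- compared through base points and chart components.
  · have hγ : ∀ s ∈ I, γ s = x 0 s := fun s hs => congrArg TotalSpace.proj (hγx s hs)
    have hball : ∀ᶠ s in 𝓝 t, s ∈ Metric.ball t₀ δ := Metric.isOpen_ball.mem_nhds ht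
    filter_upwards [hball, isOpen_Ioo.mem_nhds htI] with s hs hsI
    obtain ⟨-, -, hse⟩ := (hbox 0 h0δ s hs).self_of_nhds
    have hγs : γ =ᶠ[𝓝 s] x 0 := by
      filter_upwards [isOpen_Ioo.mem_nhds hsI] with r hr using hγ r hr
    have hcm : ContMDiffAt 𝓘(ℝ, ℝ) (𝓡 n) ∞ (x 0) s :=
      htr.smooth.contMDiffAt (isOpen_Ioo.mem_nhds hsI)
    have hγe : γ s ∈ e.source := by rw [hγ s hsI]; exact hse
    have hvel : comp e (γ s) (velocity γ s) = comp e (x 0 s) (velocity (x 0) s) := by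
      rw [comp_velocity he (hcm.congr_of_eventuallyEq hγs) hγe, comp_velocity he hcm hse]
      exact (hγs.fun_comp e).deriv_eq
    have hτs : comp e (γ s) (τ s) = comp e (x 0 s) (velocity (fun u => x u s) 0) :=
      congrArg (fun q : TangentBundle (𝓡 n) M => comp e q.1 q.2) (hγx s hsI)
    simp only [deviation]
    rw [inner_eq_gram g he hγe, hvel, hτs, hγ s hsI]

end

end

end NormalShift

theorem theorem6p3 (n : ℕ) (hn : 2 ≤ n) (M : Type*) [TopologicalSpace M]
    [ChartedSpace (NormalShift.Coord n) M] [IsManifold (𝓡 n) ∞ M]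
    (g : NormalShift.Metric n M) :
    NormalShift.WeakNormality g (NormalShift.geodesicFlow n M) := by
  intro J γ hγ
  refine ⟨fun _ => 0, fun _ => 0, contDiffOn_const, contDiffOn_const, fun τ hτ t ht => ?_⟩
  obtain ⟨ψ, hφ, hψ⟩ : ∃ ψ : ℝ → ℝ,
      (∀ᶠ s in nhds t, HasDerivAt (NormalShift.deviation g γ τ) (ψ s) s) ∧ HasDerivAt ψ 0 t :=
    hτ.2.elim (fun h => NormalShift.hasDerivAt_deviation_of_solvesVariationEq g hγ hτ.1 h ht)
      (fun h => NormalShift.hasDerivAt_deviation_of_isVariationOfFamily g h ht)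
  refine ⟨hφ.self_of_nhds.differentiableAt, ?_⟩
  simp only [zero_mul, add_zero]
  -- `ψ` depends on `t`, but near `t` it is the derivative of the deviation, which is all that the
  -- second derivative there requires.
  exact hψ.congr_of_eventuallyEq (hφ.mono fun s hs => hs.deriv)
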